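/- Let $q\ge 2$ be an even integer and $\Sigma_q=\{0,1,\dots,q-1\}$. For a word $x\in\Sigma_q^n$ let $\#_\sigma(x)$ be the number of occurrences of the symbol $\sigma$ in $x$, and for real $\varepsilon$ put $$\mathcal C_q^{(\mathrm{pb})}(n,\varepsilon)=\Big\{x\in\Sigma_q^n : \sum_{i=0}^{q/2-1}\#_i(x)\in\big[\tfrac n2-\varepsilon,\tfrac n2+\varepsilon\big]\Big\},\qquad \mathcal C(n,\varepsilon)=\Big\{x\in\Sigma_2^n : w(x)\in\big[\tfrac n2-\varepsilon,\tfrac n2+\varepsilon\big]\Big\},$$ where $w(x)$ is the Hamming weight (the number of nonzero symbols). Define $$F^{(\mathrm{pb})}(n,\alpha)=\frac{|\mathcal C_q^{(\mathrm{pb})}(n,\alpha\sqrt n)|}{q^n},\qquad F(n,\alpha)=\frac{|\mathcal C(n,\alpha\sqrt n)|}{2^n},\qquad c=\liminf_{n\to\infty}\ \inf\{\alpha>0 : F^{(\mathrm{pb})}(n,\alpha)\ge 1/q\}.$$ A single-redundancy-symbol code for $\mathcal C_q^{(\mathrm{pb})}(n,\varepsilon)$, $n\ge1$, is an injective map $\Sigma_q^{n-1}\to\mathcal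 C_q^{(\mathrm{pb})}(n,\varepsilon)$. Then: 1. $F^{(\mathrm{pb})}(n,\alpha)=F(n,\alpha)$ for all $n\ge 0$ and all real $\alpha$. 2. $c\le 0.34$. 3. $c$ is the threshold for single-redundancy-symbol codes: $c$ is the infimum of the set of $\alpha>0$ such that $F^{(\mathrm{pb})}(n,\alpha)\ge 1/q$ for all sufficiently large $n$; for every $\alpha>c$, a single-redundancy-symbol code for $\mathcal C_q^{(\mathrm{pb})}(n,\alpha\sqrt n)$ exists for all sufficiently large $n$; and for every $\alpha<c$ and all sufficiently large $n$, no such code exists. 4. The order $\sqrt n$ is necessary: there are $\kappa>0$ and $n_0$, depending only on $q$, such that for all $n\ge n_0$ and all real $\varepsilon$, if a single-redundancy-symbol code for $\mathcal C_q^{(\mathrm{pb})}(n,\varepsilon)$ exists, then $\varepsilon\ge\kappa\sqrt n$. (Together with 3, $\varepsilon(n)=\Theta(\sqrt n)$ is the right order.) -/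

import Mathlib

open Filter Topology

noncomputable section

namespace AlmostBalanced

/-- Words of length `n` over the alphabet `Σ_q = {0, …, q - 1}`. -/
abbrev Word (q n : ℕ) : Type := Fin n → Fin q

/-- `#_σ(x)`: the number of occurrences of the symbol `σ` in the word `x`. -/
def symbolCount {q n : ℕ} (σ : Fin q) (x : Word q n) : ℕ :=
  (Finset.univ.filter fun i : Fin n => x i = σ).card

/-- `∑_{σ = 0}^{q/2 - 1} #_σ(x)`: the number of entries in the lower half of the alphabet. -/
def lowerCount {q n : ℕ} (x : Word q n) : ℕ :=
  ∑ σ ∈ Finset.univ.filter (fun σ : Fin q => (σ : ℕ) < q / 2), symbolCount σ x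

/-- The binary constraint `C(n, ε)`: words of Hamming weight in `[n/2 - ε, n/2 + ε]`. -/
def binaryCode (n : ℕ) (ε : ℝ) : Set (Word 2 n) :=
  {x | (hammingNorm x : ℝ) ∈ Set.Icc ((n : ℝ) / 2 - ε) ((n : ℝ) / 2 + ε)}

/-- The polarity-balanced constraint `C_q^{(pb)}(n, ε)`. -/
def polarityCode (q n : ℕ) (ε : ℝ) : Set (Word q n) :=
  {x | (lowerCount x : ℝ) ∈ Set.Icc ((n : ℝ) / 2 - ε) ((n : ℝ) / 2 + ε)}

/-- `F(n, α) = |C(n, α √n)| / 2 ^ n`. -/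
def binaryProportion (n : ℕ) (α : ℝ) : ℝ :=
  ((binaryCode n (α * Real.sqrt n)).ncard : ℝ) / 2 ^ n

/-- `F^{(pb)}(n, α) = |C_q^{(pb)}(n, α √n)| / q ^ n`. -/
def polarityProportion (q n : ℕ) (α : ℝ) : ℝ :=
  ((polarityCode q n (α * Real.sqrt n)).ncard : ℝ) / (q : ℝ) ^ n

/-- The set `{α > 0 | F^{(pb)}(n, α) ≥ 1 / q}`. -/
def admissible (q n : ℕ) : Set ℝ :=
  {α | 0 < α ∧ 1 / (q : ℝ) ≤ polarityProportion q n α}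

/-- `c = liminf {α | F^{(pb)}(n, α) ≥ 1 / q}`: the lower limit, as `n → ∞`, of the least
admissible `α` at length `n`. -/
def polarityThreshold (q : ℕ) : ℝ :=
  liminf (fun n : ℕ => sInf (admissible q n)) atTop

/-- There is a single-redundancy-symbol code for `C_q^{(pb)}(n, ε)`: an injective encoder
from the words of length `n - 1` into the words of length `n` that satisfy the constraint.
(Meaningful for `n ≥ 1`.) -/
def HasSingleSymbolCode (q n : ℕ) (ε : ℝ) : Prop :=
  ∃ enc : Word q (n - 1) → Word q n,
    Function.Injective enc ∧ ∀ x, enc x ∈ polarityCode q n ε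

end AlmostBalanced

end

namespace AlmostBalanced

open MeasureTheory ProbabilityTheory

/-! ### Monotonicity and codes -/

/-! Recording for each symbol its half of the alphabet and its position there turns the polarity
constraint into the binary weight constraint times a free factor, so the two proportions agree
(`ncard_polarityCode`). The weight is a sum of fair bits, so by the central limit theorem the
proportion at `α` tends to the Gaussian mass of `[-2α, 2α]` (`tendsto_binaryProportion`). This mass
is continuous and strictly increasing in `α`, vanishes at `0` and is at least `1/2 ≥ 1/q` at `0.34`.
Hence it equals `1/q` at a single `c` in `(0, 0.34]`, and away from `c` the proportion is eventually
on the correct side of `1/q`.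

Counting turns this into a statement about codes, since an injection exists iff the proportion is at
least `1/q`. Positivity of `c` makes the order `√n` necessary. -/

lemma polarityCode_mono (q n : ℕ) {ε₁ ε₂ : ℝ} (h : ε₁ ≤ ε₂) :
    polarityCode q n ε₁ ⊆ polarityCode q n ε₂ := fun x hx =>
  Set.Icc_subset_Icc (by linarith) (by linarith) hx

lemma polarityProportion_mono (q n : ℕ) : Monotone (polarityProportion q n) := by
  intro α β h
  unfold polarityProportion
  gcongr
  · exact Set.toFinite _
  · exact polarityCode_mono q n (mul_le_mul_of_nonneg_right h (Real.sqrt_nonneg _))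

lemma hasSingleSymbolCode_mono {q n : ℕ} {ε₁ ε₂ : ℝ} (h : ε₁ ≤ ε₂)
    (hc : HasSingleSymbolCode q n ε₁) : HasSingleSymbolCode q n ε₂ := by
  obtain ⟨enc, hinj, hmem⟩ := hc
  exact ⟨enc, hinj, fun x => polarityCode_mono q n h (hmem x)⟩

lemma hasSingleSymbolCode_iff_card {q n : ℕ} (ε : ℝ) :
    HasSingleSymbolCode q n ε ↔ q ^ (n - 1) ≤ (polarityCode q n ε).ncard := by
  classical
  have hcard : Fintype.card (Word q (n - 1)) = q ^ (n - 1) := by simp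
  have hcard' : Fintype.card (polarityCode q n ε) = (polarityCode q n ε).ncard := by
    rw [← Nat.card_eq_fintype_card, Nat.card_coe_set_eq]
  rw [← hcard, ← hcard', ← Function.Embedding.nonempty_iff_card_le]
  constructor
  · rintro ⟨enc, hinj, hmem⟩
    exact ⟨⟨fun x => ⟨enc x, hmem x⟩, fun x y hxy => hinj (congrArg Subtype.val hxy)⟩⟩
  · rintro ⟨f⟩
    exact ⟨fun x => f x, Subtype.val_injective.comp f.injective, fun x => (f x).2⟩

lemma hasSingleSymbolCode_iff_proportion {q n : ℕ} (hq : 2 ≤ q) (hn : 1 ≤ n) (α : ℝ) :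
    HasSingleSymbolCode q n (α * Real.sqrt n) ↔ 1 / (q : ℝ) ≤ polarityProportion q n α := by
  have hq0 : (0 : ℝ) < q := by positivity
  rw [hasSingleSymbolCode_iff_card, polarityProportion, div_le_div_iff₀ hq0 (by positivity),
    one_mul]
  -- Writing `n = m + 1` removes the truncated subtraction in `n - 1`.
  obtain ⟨m, rfl⟩ := Nat.exists_eq_add_of_le' hn
  rw [Nat.add_sub_cancel, pow_succ, mul_le_mul_iff_left₀ hq0]
  norm_cast

/-! ### Comparison with binary words -/

lemma lowerCount_eq_card {q n : ℕ} (x : Word q n) :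
    lowerCount x = (Finset.univ.filter fun i : Fin n => (x i : ℕ) < q / 2).card := by
  classical
  unfold lowerCount symbolCount
  rw [Finset.card_eq_sum_card_fiberwise (f := x)
    (t := Finset.univ.filter fun σ : Fin q => (σ : ℕ) < q / 2)]
  · refine Finset.sum_congr rfl fun σ hσ => congrArg Finset.card ?_
    ext i
    simp only [Finset.mem_filter, Finset.mem_univ, true_and] at hσ ⊢
    grind
  · intro i hi
    simpa using hi

/-- Splitting a symbol of an even alphabet into its half and its position in that half. -/
def symbolSplit (m : ℕ) : Fin (2 * m) ≃ Fin 2 × Fin m :=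
  -- The reversal gives the lower half the bit `1`, because Hamming weight counts nonzero symbols.
  finProdFinEquiv.symm.trans (Equiv.prodCongr Fin.revPerm (Equiv.refl _))

lemma symbolSplit_fst_ne_zero_iff {m : ℕ} (σ : Fin (2 * m)) :
    (symbolSplit m σ).1 ≠ 0 ↔ (σ : ℕ) < 2 * m / 2 := by
  have h2 : 2 * m / 2 = m := by omega
  have hm : 0 < m := by have := σ.2; omega
  rw [h2]
  have hval : ((symbolSplit m σ).1 : ℕ) = 1 - (σ : ℕ) / m := by
    simp [symbolSplit, Fin.val_rev]
  have hlt : (σ : ℕ) / m < 2 := Nat.div_lt_of_lt_mul (by have := σ.2; linarith)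
  have h1 : (σ : ℕ) < m ↔ (σ : ℕ) / m = 0 := by
    rw [Nat.div_eq_zero_iff]; omega
  rw [h1, Ne, Fin.ext_iff, hval]
  simp only [Fin.val_zero]
  omega

lemma ncard_polarityCode (m n : ℕ) (ε : ℝ) :
    (polarityCode (2 * m) n ε).ncard = (binaryCode n ε).ncard * m ^ n := by
  classical
  let e : Word (2 * m) n ≃ Word 2 n × Word m n :=
    (Equiv.arrowCongr (Equiv.refl _) (symbolSplit m)).trans (Equiv.arrowProdEquivProdArrow ..)
  have hw (x : Word (2 * m) n) : hammingNorm (e x).1 = lowerCount x := by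
    rw [lowerCount_eq_card, hammingNorm]
    refine congrArg Finset.card (Finset.filter_congr fun i _ => ?_)
    exact symbolSplit_fst_ne_zero_iff (x i)
  have himage : e '' polarityCode (2 * m) n ε = binaryCode n ε ×ˢ Set.univ := by
    ext y
    rw [Equiv.image_eq_preimage_symm]
    simp [polarityCode, binaryCode, ← hw]
  rw [← Set.ncard_image_of_injective _ e.injective, himage, Set.ncard_prod, Set.ncard_univ]
  simp

lemma polarityProportion_eq_binaryProportion {q : ℕ} (hq : 2 ≤ q) (hqe : Even q) (n : ℕ) (α : ℝ) :
    polarityProportion q n α = binaryProportion n α := by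
  obtain ⟨m, rfl⟩ := hqe.two_dvd
  have hm : (m : ℝ) ≠ 0 := by
    norm_cast; omega
  rw [polarityProportion, binaryProportion, ncard_polarityCode]
  push_cast
  rw [mul_pow]
  field_simp

/-! ### The central limit theorem for the Hamming weight -/

/-- The symbols `0` and `1` as the signs `-1` and `1`. -/
noncomputable def bitSign (b : Fin 2) : ℝ := if b = 0 then -1 else 1

/-- The uniform probability measure on a bit. -/
noncomputable def bitMeasure : Measure (Fin 2) := uniformOn Set.univ

instance : IsProbabilityMeasure bitMeasure := by
  unfold bitMeasure; infer_instance

lemma bitMeasure_singleton (b : Fin 2) : bitMeasure {b} = 2⁻¹ := by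
  rw [bitMeasure, uniformOn_univ]
  simp

/-- The uniform probability measure on binary words. -/
noncomputable def wordMeasure (n : ℕ) : Measure (Word 2 n) := Measure.pi fun _ => bitMeasure

instance (n : ℕ) : IsProbabilityMeasure (wordMeasure n) := by
  unfold wordMeasure; infer_instance

lemma wordMeasure_real (n : ℕ) (s : Set (Word 2 n)) :
    (wordMeasure n).real s = (s.ncard : ℝ) / 2 ^ n := by
  classical
  have hs (x : Word 2 n) : (wordMeasure n).real {x} = (2 ^ n)⁻¹ := by
    simp [wordMeasure, Measure.real, Measure.pi_singleton, bitMeasure_singleton]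
  have hfin := Set.toFinite s
  rw [← hfin.coe_toFinset, ← sum_measureReal_singleton, Set.ncard_coe_finset]
  simp [hs, div_eq_mul_inv]

/-- The normalised sum of the signs of a binary word. -/
noncomputable def signSum (n : ℕ) (x : Word 2 n) : ℝ := (Real.sqrt n)⁻¹ * ∑ i, bitSign (x i)

lemma sum_bitSign {n : ℕ} (x : Word 2 n) :
    ∑ i, bitSign (x i) = 2 * (hammingNorm x : ℝ) - n := by
  have h (b : Fin 2) : bitSign b = 2 * (if b ≠ 0 then 1 else 0) - 1 := by
    unfold bitSign; split_ifs <;> first | (exfalso; tauto) | norm_num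
  simp only [h, Finset.sum_sub_distrib, ← Finset.mul_sum, Finset.sum_boole, hammingNorm]
  simp

/-- The signs sum to twice the deviation of the weight from `n / 2`, whence the factor `2`. -/
lemma preimage_signSum {n : ℕ} (hn : 1 ≤ n) (α : ℝ) :
    signSum n ⁻¹' Set.Icc (-(2 * α)) (2 * α) = binaryCode n (α * Real.sqrt n) := by
  ext x
  have hs : 0 < Real.sqrt n := Real.sqrt_pos.2 (by exact_mod_cast hn)
  simp only [Set.mem_preimage, signSum, sum_bitSign, binaryCode, Set.mem_ofPred_eq, Set.mem_Icc]
  rw [inv_mul_eq_div, le_div_iff₀ hs, div_le_iff₀ hs]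
  constructor <;> rintro ⟨h1, h2⟩ <;> constructor <;> linarith

lemma measurable_signSum (n : ℕ) : Measurable (signSum n) := measurable_of_finite _

/-- The law of the normalised sum of signs of a uniform binary word. -/
noncomputable def signSumLaw (n : ℕ) : ProbabilityMeasure ℝ :=
  ⟨(wordMeasure n).map (signSum n),
    Measure.isProbabilityMeasure_map (measurable_signSum n).aemeasurable⟩

lemma signSumLaw_real {n : ℕ} (hn : 1 ≤ n) (α : ℝ) :
    (signSumLaw n : Measure ℝ).real (Set.Icc (-(2 * α)) (2 * α)) = binaryProportion n α := by
  rw [signSumLaw, ProbabilityMeasure.coe_mk, map_measureReal_apply (measurable_signSum n)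
    measurableSet_Icc, preimage_signSum hn, wordMeasure_real, binaryProportion]

lemma charFun_signSumLaw (n : ℕ) (t : ℝ) :
    charFun (signSumLaw n : Measure ℝ) t =
      charFun (bitMeasure.map bitSign) ((Real.sqrt n)⁻¹ * t) ^ n := by
  have hindep : iIndepFun (fun (i : Fin n) (x : Word 2 n) => bitSign (x i)) (wordMeasure n) :=
    iIndepFun_pi fun _ => (measurable_of_finite _).aemeasurable
  have hmap (i : Fin n) : (wordMeasure n).map (fun x => bitSign (x i)) = bitMeasure.map bitSign := by
    have h := (measurePreserving_eval (fun _ : Fin n => bitMeasure) i).map_eq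
    conv_rhs => rw [← h]
    rw [Measure.map_map (measurable_of_finite _) (by fun_prop)]
    rfl
  have hfun : signSum n = fun x => (Real.sqrt n)⁻¹ * ∑ i, bitSign (x i) := rfl
  rw [signSumLaw, ProbabilityMeasure.coe_mk, hfun, charFun_map_mul_comp,
    hindep.charFun_map_fun_sum_eq_prod]
  · simp [hmap]
  · exact fun i => (measurable_of_finite _).aemeasurable
  · exact (measurable_of_finite _).aemeasurable

lemma integral_bitMeasure (f : Fin 2 → ℝ) : ∫ b, f b ∂bitMeasure = (f 0 + f 1) / 2 := by
  rw [integral_fintype .of_finite]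
  simp [Measure.real, bitMeasure_singleton]
  ring

lemma tendsto_signSumLaw :
    Tendsto signSumLaw atTop (𝓝 (⟨gaussianReal 0 1, inferInstance⟩ : ProbabilityMeasure ℝ)) := by
  refine ProbabilityMeasure.tendsto_iff_tendsto_charFun.2 fun t => ?_
  -- The signs have mean `0` and second moment `1`, so no further normalisation is needed.
  have h := tendsto_charFun_inv_sqrt_mul_pow (P := bitMeasure) (X := bitSign)
    (measurable_of_finite _).aemeasurable (by rw [integral_bitMeasure]; simp [bitSign])
    (by rw [integral_bitMeasure]; simp [bitSign]) t
  simpa [charFun_signSumLaw, charFun_gaussianReal, neg_div] using h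

/-! ### The limiting proportion -/

/-- The standard Gaussian probability of `[-a, a]`. -/
noncomputable def gaussianMass (a : ℝ) : ℝ := ∫ x in (-a)..a, gaussianPDFReal 0 1 x

lemma gaussianReal_real_Icc {a : ℝ} (ha : 0 ≤ a) :
    (gaussianReal 0 1).real (Set.Icc (-a) a) = gaussianMass a := by
  rw [gaussianMass, intervalIntegral.integral_of_le (by linarith), ← integral_Icc_eq_integral_Ioc,
    Measure.real, gaussianReal_apply_eq_integral _ one_ne_zero, ENNReal.toReal_ofReal]
  exact integral_nonneg fun x => gaussianPDFReal_nonneg 0 1 x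

/-- Weak convergence passes to the interval because its two endpoints are Gaussian-null. -/
lemma tendsto_binaryProportion {α : ℝ} (hα : 0 ≤ α) :
    Tendsto (fun n => binaryProportion n α) atTop (𝓝 (gaussianMass (2 * α))) := by
  have : NullSingletonClass (gaussianReal 0 1) := nullSingletonClass_gaussianReal one_ne_zero
  have hfr : gaussianReal 0 1 (frontier (Set.Icc (-(2 * α)) (2 * α))) = 0 := by
    rw [frontier_Icc (by linarith)]
    exact (Set.toFinite _).measure_zero _
  have h := ProbabilityMeasure.tendsto_measure_of_null_frontier_of_tendsto'
    tendsto_signSumLaw hfr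
  have h' := (ENNReal.tendsto_toReal (measure_ne_top (gaussianReal 0 1) _)).comp h
  rw [← gaussianReal_real_Icc (by linarith)]
  refine h'.congr' ?_
  filter_upwards [eventually_ge_atTop 1] with n hn
  exact signSumLaw_real hn α

lemma continuous_gaussianPDFReal : Continuous (gaussianPDFReal 0 1) := by
  rw [gaussianPDFReal_def]; fun_prop

lemma intervalIntegrable_gaussianPDFReal (a b : ℝ) :
    IntervalIntegrable (gaussianPDFReal 0 1) volume a b :=
  continuous_gaussianPDFReal.intervalIntegrable a b

lemma gaussianMass_zero : gaussianMass 0 = 0 := by simp [gaussianMass]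

lemma gaussianMass_strictMono : StrictMono gaussianMass := by
  intro a b hab
  have hpos {u v : ℝ} (huv : u < v) : 0 < ∫ x in u..v, gaussianPDFReal 0 1 x :=
    intervalIntegral.intervalIntegral_pos_of_pos (intervalIntegrable_gaussianPDFReal u v)
      (fun x => gaussianPDFReal_pos 0 1 x one_ne_zero) huv
  have hI := intervalIntegrable_gaussianPDFReal
  have h1 := intervalIntegral.integral_add_adjacent_intervals (hI (-b) (-a)) (hI (-a) a)
  have h2 := intervalIntegral.integral_add_adjacent_intervals (hI (-b) a) (hI a b)
  have h3 := hpos (neg_lt_neg hab)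
  have h4 := hpos hab
  unfold gaussianMass
  linarith

lemma continuous_gaussianMass : Continuous gaussianMass := by
  have hI := intervalIntegrable_gaussianPDFReal
  have hc : Continuous fun a => ∫ x in (0 : ℝ)..a, gaussianPDFReal 0 1 x :=
    intervalIntegral.continuous_primitive hI 0
  have h : gaussianMass = fun a => (∫ x in (0 : ℝ)..a, gaussianPDFReal 0 1 x) -
      ∫ x in (0 : ℝ)..(-a), gaussianPDFReal 0 1 x := by
    funext a
    exact (intervalIntegral.integral_interval_sub_left (hI _ _) (hI _ _)).symm
  rw [h]
  exact hc.sub (hc.comp continuous_neg)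

/-- From `exp (-x²/2) ≥ 1 - x²/2`, the mass is at least `(1.36 - 0.68³/3) / √(2π)`. The numerator
exceeds `1.255 = 2.51 / 2`, so `√(2π) ≤ 2.51` just suffices. -/
lemma half_le_gaussianMass : 1 / 2 ≤ gaussianMass (2 * 0.34) := by
  have hle : ∫ x in (-(2 * 0.34 : ℝ))..(2 * 0.34), (Real.sqrt (2 * Real.pi))⁻¹ * (1 - x ^ 2 / 2) ≤
      gaussianMass (2 * 0.34) := by
    refine intervalIntegral.integral_mono_on (by norm_num)
      (Continuous.intervalIntegrable (by fun_prop) _ _)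
      (intervalIntegrable_gaussianPDFReal _ _) fun x _ => ?_
    have h := Real.add_one_le_exp (-(x ^ 2) / 2)
    simp only [gaussianPDFReal, NNReal.coe_one, mul_one, sub_zero]
    gcongr
    linarith
  refine le_trans ?_ hle
  have hsq : Real.sqrt (2 * Real.pi) ≤ 2.51 := by
    rw [Real.sqrt_le_left (by norm_num)]
    nlinarith [Real.pi_lt_d2]
  have hpos : 0 < Real.sqrt (2 * Real.pi) := by positivity
  rw [intervalIntegral.integral_const_mul, intervalIntegral.integral_sub (by simp)
    (Continuous.intervalIntegrable (by fun_prop) _ _), intervalIntegral.integral_div, integral_pow,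
    inv_mul_eq_div, le_div_iff₀ hpos]
  norm_num at hsq ⊢
  linarith

/-! ### The threshold -/

/-- The solution of the limiting equation for the threshold. -/
lemma exists_gaussianMass_eq {q : ℕ} (hq : 2 ≤ q) :
    ∃ c : ℝ, 0 < c ∧ c ≤ 0.34 ∧ gaussianMass (2 * c) = 1 / q := by
  have hq' : (2 : ℝ) ≤ q := by exact_mod_cast hq
  have hq0 : (0 : ℝ) < 1 / q := by positivity
  have hcont : Continuous fun c : ℝ => gaussianMass (2 * c) :=
    continuous_gaussianMass.comp (continuous_const_mul 2)
  obtain ⟨c, hc, hc'⟩ := intermediate_value_Icc (a := (0 : ℝ)) (b := 0.34) (by norm_num)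
    hcont.continuousOn (show 1 / (q : ℝ) ∈ _ from ⟨by simp [gaussianMass_zero],
      (one_div_le_one_div_of_le two_pos hq').trans half_le_gaussianMass⟩)
  refine ⟨c, lt_of_le_of_ne hc.1 ?_, hc.2, hc'⟩
  rintro rfl
  simp only [mul_zero, gaussianMass_zero] at hc'
  exact hq0.ne hc'

section Threshold

variable {q : ℕ} {c : ℝ}

lemma eventually_le_polarityProportion (hq : 2 ≤ q) (hqe : Even q) (hc0 : 0 < c)
    (hc : gaussianMass (2 * c) = 1 / q) {α : ℝ} (hα : c < α) :
    ∀ᶠ n : ℕ in atTop, 1 / (q : ℝ) ≤ polarityProportion q n α := by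
  have hlim := tendsto_binaryProportion (hc0.trans hα).le
  have hlt : 1 / (q : ℝ) < gaussianMass (2 * α) := hc ▸ gaussianMass_strictMono (by linarith)
  filter_upwards [hlim.eventually_const_lt hlt] with n hn
  rw [polarityProportion_eq_binaryProportion hq hqe]
  exact hn.le

lemma eventually_polarityProportion_lt (hq : 2 ≤ q) (hqe : Even q) (hc0 : 0 < c)
    (hc : gaussianMass (2 * c) = 1 / q) {α : ℝ} (hα : α < c) :
    ∀ᶠ n : ℕ in atTop, polarityProportion q n α < 1 / (q : ℝ) := by
  -- The limit is available only for nonnegative arguments; monotonicity covers negative `α`.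
  have hlim := tendsto_binaryProportion (le_max_right α 0)
  have hlt : gaussianMass (2 * max α 0) < 1 / (q : ℝ) :=
    hc ▸ gaussianMass_strictMono (by linarith [max_lt hα hc0])
  filter_upwards [hlim.eventually_lt_const hlt] with n hn
  refine (polarityProportion_mono q n (le_max_left α 0)).trans_lt ?_
  rwa [polarityProportion_eq_binaryProportion hq hqe]

/-- The infima in fact converge to `c`, so the lower limit is a limit. -/
lemma polarityThreshold_eq (hq : 2 ≤ q) (hqe : Even q) (hc0 : 0 < c)
    (hc : gaussianMass (2 * c) = 1 / q) : polarityThreshold q = c := by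
  refine Tendsto.liminf_eq (tendsto_order.2 ⟨fun a ha => ?_, fun a ha => ?_⟩)
  · obtain ⟨b, hab, hbc⟩ := exists_between ha
    filter_upwards [eventually_polarityProportion_lt hq hqe hc0 hc hbc,
      eventually_le_polarityProportion hq hqe hc0 hc (lt_add_one c)] with n hn hn'
    -- The element `c + 1` shows the set is nonempty, ruling out the default value `sInf ∅ = 0`.
    refine hab.trans_le (le_csInf ⟨c + 1, by positivity, hn'⟩ fun β hβ => ?_)
    by_contra! hlt
    exact (hβ.2.trans (polarityProportion_mono q n hlt.le)).not_gt hn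
  · obtain ⟨b, hcb, hba⟩ := exists_between ha
    filter_upwards [eventually_le_polarityProportion hq hqe hc0 hc hcb] with n hn
    have hbdd : BddBelow (admissible q n) := ⟨0, fun β hβ => hβ.1.le⟩
    exact (csInf_le hbdd ⟨hc0.trans hcb, hn⟩).trans_lt hba

end Threshold

end AlmostBalanced

theorem mainTheorem5 (q : ℕ) (hq : 2 ≤ q) (hqe : Even q) :
    -- the q-ary polarity-balanced proportion equals the binary proportion
    (∀ (n : ℕ) (α : ℝ),
      AlmostBalanced.polarityProportion q n α = AlmostBalanced.binaryProportion n α) ∧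
    -- the bound on the threshold
    AlmostBalanced.polarityThreshold q ≤ 0.34 ∧
    -- it is also the least `α` (as an infimum) that is admissible for all large `n`
    IsGLB {α : ℝ | ∀ᶠ n : ℕ in Filter.atTop, α ∈ AlmostBalanced.admissible q n}
      (AlmostBalanced.polarityThreshold q) ∧
    -- it is the threshold for single-redundancy-symbol codes
    (∀ α : ℝ, AlmostBalanced.polarityThreshold q < α → ∀ᶠ n : ℕ in Filter.atTop,
      AlmostBalanced.HasSingleSymbolCode q n (α * Real.sqrt n)) ∧
    (∀ α : ℝ, α < AlmostBalanced.polarityThreshold q → ∀ᶠ n : ℕ in Filter.atTop,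
      ¬ AlmostBalanced.HasSingleSymbolCode q n (α * Real.sqrt n)) ∧
    -- any `ε` that allows such a code is at least of order `√n`
    (∃ κ : ℝ, 0 < κ ∧ ∀ᶠ n : ℕ in Filter.atTop, ∀ ε : ℝ,
      AlmostBalanced.HasSingleSymbolCode q n ε → κ * Real.sqrt n ≤ ε) := by
  obtain ⟨c, hc0, hc34, hc⟩ := AlmostBalanced.exists_gaussianMass_eq hq
  have hno : ∀ α : ℝ, α < c → ∀ᶠ n : ℕ in Filter.atTop,
      ¬ AlmostBalanced.HasSingleSymbolCode q n (α * Real.sqrt n) := fun α hα => by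
    filter_upwards [AlmostBalanced.eventually_polarityProportion_lt hq hqe hc0 hc hα,
      Filter.eventually_ge_atTop 1] with n hn hn1
    rw [AlmostBalanced.hasSingleSymbolCode_iff_proportion hq hn1]
    exact hn.not_ge
  rw [AlmostBalanced.polarityThreshold_eq hq hqe hc0 hc]
  refine ⟨AlmostBalanced.polarityProportion_eq_binaryProportion hq hqe, hc34, ⟨?_, ?_⟩, ?_, hno,
    ⟨c / 2, by positivity, ?_⟩⟩
  · intro α hα
    by_contra! hlt
    obtain ⟨n, hn, hn'⟩ := (Filter.Eventually.and hα
      (AlmostBalanced.eventually_polarityProportion_lt hq hqe hc0 hc hlt)).exists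
    exact hn.2.not_gt hn'
  · intro b hb
    refine le_of_forall_gt_imp_ge_of_dense fun α hα => hb ?_
    filter_upwards [AlmostBalanced.eventually_le_polarityProportion hq hqe hc0 hc hα] with n hn
    exact ⟨hc0.trans hα, hn⟩
  · intro α hα
    filter_upwards [AlmostBalanced.eventually_le_polarityProportion hq hqe hc0 hc hα,
      Filter.eventually_ge_atTop 1] with n hn hn1
    exact (AlmostBalanced.hasSingleSymbolCode_iff_proportion hq hn1 α).2 hn
  -- Any positive constant below `c` would serve as `κ`: a code with smaller `ε` would also be one
  -- for `κ√n`.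
  · filter_upwards [hno (c / 2) (by linarith)] with n hn ε hε
    by_contra! hlt
    exact hn (AlmostBalanced.hasSingleSymbolCode_mono hlt.le hε)
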